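/- Let $a,h,\beta>0$. For each $N\ge 1$ let $(\xi_\sigma)_{\sigma\in\{+1,-1\}^N}$ be i.i.d. $\mathcal N(0,\tfrac1N)$ random variables (for different $N$ they live on one probability space, with arbitrary joint dependence between different $N$), and let $$H_N(\sigma)=aN\xi_\sigma+h\sum_{i=1}^N\sigma_i,\qquad Z_N(\beta,h)=\sum_{\sigma\in\{+1,-1\}^N}e^{-\beta H_N(\sigma)} .$$ For $-1<y<1$ put $\mathcal I_0(y)=y\tanh^{-1}y-\log\cosh(\tanh^{-1}y)$. Then the equation $$\frac{a\tanh^{-1}(y)}{\sqrt{2[\log 2-\mathcal I_0(y)]}}=h$$ has exactly one solution $y_0\in[0,1)$, and if $\beta\le\frac1a\sqrt{2\log2}$, then $\mathcal I_0(c)=\log2-\frac12\beta^2a^2$ has exactly one solution $c_\beta\in[0,1)$. Put $x_0=\frac{a\tanh^{-1}y_0}{h}$. Then, almost surely, the limiting free energy $\mathcal E(\beta,h)=\lim_{N\to\infty}\frac1N\log Z_N(\beta,h)$ exists and $$\mathcal E(\beta,h)=\begin{cases}\log2+\dfrac{\beta^2a^2}{2}+\log\cosh(\beta h)&\text{if }\beta\le\frac1a\sqrt{2\log2}\text{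 and }y_0\le c_\beta,\\[1ex]\beta(ax_0+hy_0)&\text{otherwise.}\end{cases}$$ -/

import Mathlib

open MeasureTheory ProbabilityTheory Filter Topology

namespace GaussianREM

/-- Configurations of the `N`-particle system: sequences of spins `+1`, `-1` of length `N`. -/
abbrev Config (N : ℕ) : Type := Fin N → ℤˣ

/-- The sum of the spins of a configuration, as a real number. -/
def spinSum {N : ℕ} (σ : Config N) : ℝ := ∑ i, (((σ i : ℤˣ) : ℤ) : ℝ)

/-- The Hamiltonian `H_N(σ) = a N ξ_σ + h ∑ σ_i`, for a realisation `x` of the disorder `ξ`. -/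
def hamiltonian (a h : ℝ) {N : ℕ} (x : Config N → ℝ) (σ : Config N) : ℝ :=
  a * (N : ℝ) * x σ + h * spinSum σ

/-- The partition function `Z_N(β, h) = ∑_σ exp (-β H_N(σ))`. -/
noncomputable def partitionFunction (β a h : ℝ) {N : ℕ} (x : Config N → ℝ) : ℝ :=
  ∑ σ : Config N, Real.exp (-β * hamiltonian a h x σ)

/-- `(1/N) log Z_N(β, h)`; its limit as `N → ∞` is the limiting free energy. -/
noncomputable def freeEnergy (β a h : ℝ) {N : ℕ} (x : Config N → ℝ) : ℝ :=
  (1 / (N : ℝ)) * Real.log (partitionFunction β a h x)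

/-- The rate function `I₀(y) = y tanh⁻¹ y - log cosh (tanh⁻¹ y)`; it is used for `-1 < y < 1`. -/
noncomputable def rate (y : ℝ) : ℝ :=
  y * Real.artanh y - Real.log (Real.cosh (Real.artanh y))

/-- `y` is a non-negative solution, in the domain `(-1, 1)` of `tanh⁻¹`, of
`a tanh⁻¹ y / √(2 (log 2 - I₀ y)) = h`. -/
def IsYZero (a h y : ℝ) : Prop :=
  0 ≤ y ∧ y < 1 ∧ a * Real.artanh y / √(2 * (Real.log 2 - rate y)) = h

/-- `c` is a non-negative solution, in the domain `(-1, 1)` of `tanh⁻¹`, of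
`I₀ c = log 2 - β² a² / 2`. -/
def IsCBeta (β a c : ℝ) : Prop :=
  0 ≤ c ∧ c < 1 ∧ rate c = Real.log 2 - β ^ 2 * a ^ 2 / 2

end GaussianREM

namespace GaussianREM

/-! About `exp (N (log 2 - x²/2 - rate (tanh t)))` configurations have disorder near `-x` and
magnetization near `-tanh t`, as long as this exponent is positive. Maximizing `β (a x + h tanh t)`
plus the exponent without constraint gives `x = β a`, `t = β h` and the annealed free energy. The
annealed upper bound (`ae_eventually_freeEnergy_le`) is a first-moment estimate. The lower bound
(`ae_eventually_le_freeEnergy`) counts the configurations above with Chebyshev. They agree when the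
unconstrained maximizer is admissible. Along the ray `(β a, β h)` the constraint becomes tight at
`(x₀, t)` with `y₀ = tanh t`, reached at the critical value `b = t / h = x₀ / a`. Beyond `b`,
monotonicity of `ℓ^p` norms (`freeEnergy_mul_le`) bounds the free energy by `β / b` times its value
at `b`, which is the contribution of `(x₀, t)`. The condition `y₀ ≤ c_β` says `β ≤ b`. -/

/-! ### The rate function in the coordinate `t = artanh y`. -/

lemma rate_tanh (t : ℝ) :
    rate (Real.tanh t) = t * Real.tanh t - Real.log (Real.cosh t) := by
  simp only [rate, Real.artanh_tanh]; ring

lemma hasDerivAt_log_cosh (t : ℝ) :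
    HasDerivAt (fun u => Real.log (Real.cosh u)) (Real.tanh t) t := by
  rw [Real.tanh_eq_sinh_div_cosh]
  exact (Real.hasDerivAt_cosh t).log (Real.cosh_pos t).ne'

lemma hasDerivAt_tanh (t : ℝ) :
    HasDerivAt Real.tanh (1 / Real.cosh t ^ 2) t := by
  have h := (Real.hasDerivAt_sinh t).div (Real.hasDerivAt_cosh t) (Real.cosh_pos t).ne'
  have e : Real.tanh = Real.sinh / Real.cosh := by
    funext u; exact Real.tanh_eq_sinh_div_cosh u
  rw [e]
  refine h.congr_deriv ?_
  rw [← Real.cosh_sq_sub_sinh_sq t]; ring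

lemma hasDerivAt_rate_tanh (t : ℝ) :
    HasDerivAt (fun u => rate (Real.tanh u)) (t / Real.cosh t ^ 2) t := by
  simp only [rate_tanh]
  refine (((hasDerivAt_id t).mul (hasDerivAt_tanh t)).sub (hasDerivAt_log_cosh t)).congr_deriv ?_
  simp only [id]; ring

lemma continuous_rate_tanh : Continuous fun u => rate (Real.tanh u) :=
  continuous_iff_continuousAt.2 fun t => (hasDerivAt_rate_tanh t).continuousAt

lemma strictMonoOn_rate_tanh :
    StrictMonoOn (fun u => rate (Real.tanh u)) (Set.Ici 0) := by
  refine strictMonoOn_of_deriv_pos (convex_Ici 0) continuous_rate_tanh.continuousOn fun t ht => ?_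
  rw [interior_Ici] at ht
  rw [(hasDerivAt_rate_tanh t).deriv]
  exact div_pos ht (pow_pos (Real.cosh_pos t) 2)

lemma rate_tanh_zero : rate (Real.tanh 0) = 0 := by rw [rate_tanh]; simp

/-- Writing `log cosh t = t + log (1 + exp (-2t)) - log 2` leaves only the errors `t (1 - tanh t)`
and `log (1 + exp (-2t))`, both exponentially small up to a factor `t`. -/
lemma tendsto_rate_tanh : Tendsto (fun t => rate (Real.tanh t)) atTop (𝓝 (Real.log 2)) := by
  have key : ∀ t, 0 ≤ t → Real.log 2 - 2 * (t * Real.exp (-t)) - Real.exp (-t)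
      ≤ rate (Real.tanh t) ∧ rate (Real.tanh t) ≤ Real.log 2 := by
    intro t ht
    have hc := Real.cosh_pos t
    have e1 : 1 - Real.tanh t = Real.exp (-t) / Real.cosh t := by
      rw [Real.tanh_eq_sinh_div_cosh, ← Real.cosh_sub_sinh]; field_simp
    have hc1 : 1 ≤ Real.cosh t := Real.one_le_cosh t
    have e2 : Real.cosh t = Real.exp t * (1 + Real.exp (-t) ^ 2) / 2 := by
      rw [Real.cosh_eq, mul_add, pow_two, ← mul_assoc, ← Real.exp_add]; simp
    have e3 : Real.log (Real.cosh t) = t + Real.log (1 + Real.exp (-t) ^ 2) - Real.log 2 := by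
      rw [e2, Real.log_div (by positivity) (by norm_num), Real.log_mul (by positivity)
        (by positivity), Real.log_exp]
    have h1 : Real.log (1 + Real.exp (-t) ^ 2) ≤ Real.exp (-t) ^ 2 := by
      have := Real.log_le_sub_one_of_pos (show 0 < 1 + Real.exp (-t) ^ 2 by positivity)
      linarith
    have h2 : 0 ≤ Real.log (1 + Real.exp (-t) ^ 2) := Real.log_nonneg (by nlinarith [sq_nonneg (Real.exp (-t))])
    have h3 : Real.exp (-t) ≤ 1 := Real.exp_le_one_iff.2 (by linarith)
    have h0 := Real.exp_pos (-t)
    have e4 : rate (Real.tanh t) = Real.log 2 - t * (1 - Real.tanh t)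
        - Real.log (1 + Real.exp (-t) ^ 2) := by rw [rate_tanh, e3]; ring
    have h5 : 0 ≤ 1 - Real.tanh t := by linarith [Real.tanh_lt_one t]
    have h6 : 1 - Real.tanh t ≤ Real.exp (-t) := by
      rw [e1]; exact div_le_self h0.le hc1
    rw [e4]
    constructor
    · nlinarith [mul_le_mul_of_nonneg_left h6 ht, mul_nonneg ht h0.le]
    · nlinarith [mul_nonneg ht h5]
  have l1 : Tendsto (fun t : ℝ => t * Real.exp (-t)) atTop (𝓝 0) := by
    simpa using Real.tendsto_pow_mul_exp_neg_atTop_nhds_zero 1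
  have l2 : Tendsto (fun t : ℝ => Real.exp (-t)) atTop (𝓝 0) := Real.tendsto_exp_neg_atTop_nhds_zero
  have l3 := ((tendsto_const_nhds (x := Real.log 2)).sub (l1.const_mul 2)).sub l2
  simp only [mul_zero, sub_zero] at l3
  exact tendsto_of_tendsto_of_tendsto_of_le_of_le' l3 tendsto_const_nhds
    ((eventually_ge_atTop 0).mono fun t ht => (key t ht).1)
    ((eventually_ge_atTop 0).mono fun t ht => (key t ht).2)

lemma rate_tanh_lt {t : ℝ} (ht : 0 ≤ t) : rate (Real.tanh t) < Real.log 2 := by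
  have h1 : rate (Real.tanh t) < rate (Real.tanh (t + 1)) :=
    strictMonoOn_rate_tanh ht (by simp only [Set.mem_Ici]; linarith) (by linarith)
  refine h1.trans_le (ge_of_tendsto tendsto_rate_tanh ?_)
  filter_upwards [eventually_ge_atTop (t + 1)] with u hu
  exact strictMonoOn_rate_tanh.monotoneOn (by simp only [Set.mem_Ici]; linarith)
    (by simp only [Set.mem_Ici]; linarith) hu

lemma tanh_nonneg {t : ℝ} (ht : 0 ≤ t) : 0 ≤ Real.tanh t := by
  rw [Real.tanh_eq_sinh_div_cosh]
  exact div_nonneg (Real.sinh_nonneg_iff.2 ht) (Real.cosh_pos t).le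

lemma exists_eq_tanh {y : ℝ} (h0 : 0 ≤ y) (h1 : y < 1) : ∃ t, 0 ≤ t ∧ y = Real.tanh t :=
  ⟨Real.artanh y, Real.artanh_nonneg h0, (Real.tanh_artanh ⟨by linarith, h1⟩).symm⟩

lemma existsUnique_isYZero {a h : ℝ} (ha : 0 < a) (hh : 0 < h) : ∃! y, IsYZero a h y := by
  set φ : ℝ → ℝ := fun t => a * t / √(2 * (Real.log 2 - rate (Real.tanh t))) with hφ
  have hpos : ∀ t, 0 ≤ t → 0 < √(2 * (Real.log 2 - rate (Real.tanh t))) := fun t ht =>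
    Real.sqrt_pos.2 (by linarith [rate_tanh_lt ht])
  have hmono : StrictMonoOn φ (Set.Ici 0) := by
    intro s hs t ht hst
    have h1 := strictMonoOn_rate_tanh hs ht hst
    have h2 : √(2 * (Real.log 2 - rate (Real.tanh t))) ≤ √(2 * (Real.log 2 - rate (Real.tanh s))) :=
      Real.sqrt_le_sqrt (by simp only at h1; linarith)
    exact div_lt_div₀ (by nlinarith) h2 (mul_nonneg ha.le (le_of_lt (lt_of_le_of_lt hs hst)))
      (hpos t ht)
  have hcont : ContinuousOn φ (Set.Ici 0) := by
    refine ContinuousOn.div (by fun_prop) ?_ fun t ht => (hpos t ht).ne'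
    exact (Real.continuous_sqrt.comp
      (continuous_const.mul (continuous_const.sub continuous_rate_tanh))).continuousOn
  obtain ⟨t, ht, hφt⟩ : ∃ t, 0 ≤ t ∧ φ t = h := by
    -- Since the rate is nonnegative, the denominator of `φ` is at most `√(2 log 2)`; this `T`
    -- therefore gives `φ T ≥ h`.
    set T := h * √(2 * Real.log 2) / a with hT
    have hT0 : 0 ≤ T := by positivity
    have hTh : h ≤ φ T := by
      have : a * T = h * √(2 * Real.log 2) := by rw [hT]; field_simp
      simp only [hφ]
      rw [le_div_iff₀ (hpos T hT0), this]
      refine mul_le_mul_of_nonneg_left (Real.sqrt_le_sqrt ?_) hh.le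
      have := strictMonoOn_rate_tanh.monotoneOn (Set.self_mem_Ici) hT0 hT0
      simp only [rate_tanh_zero] at this
      linarith
    have := intermediate_value_Icc hT0 (hcont.mono Set.Icc_subset_Ici_self)
    obtain ⟨t, ht, e⟩ := this (show h ∈ Set.Icc (φ 0) (φ T) from ⟨by simp [hφ, hh.le], hTh⟩)
    exact ⟨t, ht.1, e⟩
  refine ⟨Real.tanh t, ⟨tanh_nonneg ht, Real.tanh_lt_one t, by simpa [hφ, Real.artanh_tanh] using hφt⟩, ?_⟩
  rintro y ⟨hy0, hy1, hy⟩
  obtain ⟨s, hs, rfl⟩ := exists_eq_tanh hy0 hy1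
  rw [Real.artanh_tanh] at hy
  rw [hmono.injOn hs ht (show φ s = φ t from hy.trans hφt.symm)]

lemma existsUnique_isCBeta {a β : ℝ} (ha : 0 < a) (hβ : 0 < β)
    (hle : β ≤ (1 / a) * √(2 * Real.log 2)) : ∃! c, IsCBeta β a c := by
  have h1 : β ^ 2 * a ^ 2 ≤ 2 * Real.log 2 := by
    have h2 : β * a ≤ √(2 * Real.log 2) := by
      rwa [one_div, inv_mul_eq_div, le_div_iff₀ ha] at hle
    have := pow_le_pow_left₀ (by positivity) h2 2
    rwa [Real.sq_sqrt (by positivity), mul_pow] at this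
  have h3 : 0 < β ^ 2 * a ^ 2 := by positivity
  obtain ⟨t, ht, he⟩ : ∃ t, 0 ≤ t ∧ rate (Real.tanh t) = Real.log 2 - β ^ 2 * a ^ 2 / 2 := by
    obtain ⟨T, hT0, hT⟩ := ((eventually_ge_atTop (0 : ℝ)).and
      (tendsto_rate_tanh.eventually_const_le
        (show Real.log 2 - β ^ 2 * a ^ 2 / 2 < Real.log 2 by linarith))).exists
    obtain ⟨t, ht, e⟩ := intermediate_value_Icc hT0 continuous_rate_tanh.continuousOn
      (show Real.log 2 - β ^ 2 * a ^ 2 / 2 ∈ Set.Icc _ _ from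
        ⟨by rw [rate_tanh_zero]; linarith, hT⟩)
    exact ⟨t, ht.1, e⟩
  refine ⟨Real.tanh t, ⟨tanh_nonneg ht, Real.tanh_lt_one t, he⟩, ?_⟩
  rintro y ⟨hy0, hy1, hy⟩
  obtain ⟨s, hs, rfl⟩ := exists_eq_tanh hy0 hy1
  rw [strictMonoOn_rate_tanh.injOn hs ht (hy.trans he.symm)]

/-! ### Entropy of the magnetization, Gaussian tails, Borel–Cantelli, and norm monotonicity. -/

lemma sum_exp_mul_spinSum (N : ℕ) (s : ℝ) :
    ∑ σ : Config N, Real.exp (s * spinSum σ) = (2 * Real.cosh s) ^ N := by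
  have h := Finset.prod_univ_sum (fun _ : Fin N => (Finset.univ : Finset ℤˣ))
    (fun _ u => Real.exp (s * ((u : ℤ) : ℝ)))
  rw [Fintype.piFinset_univ] at h
  have e : ∑ u : ℤˣ, Real.exp (s * ((u : ℤ) : ℝ)) = 2 * Real.cosh s := by
    have : (Finset.univ : Finset ℤˣ) = {1, -1} := by decide
    rw [this, Finset.sum_pair (by decide), Real.cosh_eq]
    simp; ring
  simp only [e, Finset.prod_const, Finset.card_univ, Fintype.card_fin] at h
  rw [h]
  refine Finset.sum_congr rfl fun σ _ => ?_
  rw [← Real.exp_sum, spinSum, Finset.mul_sum]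

lemma two_mul_cosh_pow (N : ℕ) (s : ℝ) :
    (2 * Real.cosh s) ^ N = Real.exp (N * (Real.log 2 + Real.log (Real.cosh s))) := by
  rw [← Real.log_mul (by norm_num) (Real.cosh_pos s).ne', Real.exp_nat_mul, Real.exp_log]
  have := Real.cosh_pos s
  positivity

/-- Exponential tilting: the configurations with magnetization at most `-N (tanh t - δ)` have
exponential growth rate at least `log 2 - rate (tanh t) - t δ`. -/
lemma eventually_le_card_spinSum_le {t δ : ℝ} (ht : 0 ≤ t) (hδ : 0 < δ) :
    ∀ᶠ N : ℕ in atTop, 1 / 2 * Real.exp (N * (Real.log 2 - rate (Real.tanh t) - t * δ)) ≤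
      (Finset.univ.filter fun σ : Config N => spinSum σ ≤ -(N * (Real.tanh t - δ))).card := by
  set y := Real.tanh t with hy
  set l : ℝ → ℝ := fun u => Real.log (Real.cosh u) with hl
  have hd : HasDerivAt l y t := hasDerivAt_log_cosh t
  -- The linearization error of `log cosh` is at most `δ|s|/2`, so both Chernoff exponents below are
  -- at most `-sδ/2`.
  have hlittle := (hasDerivAt_iff_isLittleO_nhds_zero.1 hd).def (half_pos hδ)
  obtain ⟨s, hs, hs1, hs2⟩ : ∃ s : ℝ, 0 < s ∧ l (t + s) - l t - s * (y + δ) < 0 ∧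
      l (t - s) - l t + s * (y - δ) < 0 := by
    obtain ⟨r, hr, hball⟩ := Metric.eventually_nhds_iff.1 hlittle
    have b1 := hball (y := r / 2) (by simp [abs_of_pos hr, hr])
    have b2 := hball (y := -(r / 2)) (by simp [abs_of_pos hr, hr])
    simp only [Real.norm_eq_abs, abs_neg, smul_eq_mul, abs_of_pos (half_pos hr)] at b1 b2
    have c1 := (abs_le.1 b1).2
    have c2 := (abs_le.1 b2).2
    refine ⟨r / 2, by positivity, by nlinarith, ?_⟩
    rw [sub_eq_add_neg t]
    nlinarith
  have lim : ∀ {κ : ℝ}, κ < 0 → ∀ᶠ N : ℕ in atTop, Real.exp (N * κ) ≤ 1 / 4 := by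
    intro κ hκ
    have h1 : Tendsto (fun N : ℕ => Real.exp (N * κ)) atTop (𝓝 0) :=
      Real.tendsto_exp_atBot.comp (tendsto_natCast_atTop_atTop.atTop_mul_const_of_neg hκ)
    exact h1.eventually_le_const (by norm_num)
  filter_upwards [lim hs1, lim hs2] with N h1 h2
  set A := Finset.univ.filter fun σ : Config N => spinSum σ ≤ -(N * (y - δ)) with hA
  -- Under the weight `exp (-t * spinSum σ)` the magnetization concentrates at `-N y`. The first two
  -- terms are Chernoff bounds for the two tails, each at most a quarter of the total weight `E`;
  -- the configurations left over carry the other half.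
  have hpt : ∀ σ : Config N, Real.exp (-t * spinSum σ) ≤
      Real.exp (-(t + s) * spinSum σ) * Real.exp (-(N * (s * (y + δ)))) +
      Real.exp (-(t - s) * spinSum σ) * Real.exp (N * (s * (y - δ))) +
      if σ ∈ A then Real.exp (t * (N * (y + δ))) else 0 := by
    intro σ
    rw [← Real.exp_add, ← Real.exp_add]
    by_cases hσ : σ ∈ A
    · rw [if_pos hσ]
      rcases le_total (-(N * (y + δ))) (spinSum σ) with hc | hc
      · have : Real.exp (-t * spinSum σ) ≤ Real.exp (t * (N * (y + δ))) :=
          Real.exp_le_exp.2 (by nlinarith)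
        linarith [Real.exp_pos (-(t + s) * spinSum σ + -(N * (s * (y + δ)))),
          Real.exp_pos (-(t - s) * spinSum σ + N * (s * (y - δ)))]
      · have : Real.exp (-t * spinSum σ) ≤
            Real.exp (-(t + s) * spinSum σ + -(N * (s * (y + δ)))) :=
          Real.exp_le_exp.2 (by nlinarith)
        linarith [Real.exp_pos (t * (N * (y + δ))),
          Real.exp_pos (-(t - s) * spinSum σ + N * (s * (y - δ)))]
    · rw [if_neg hσ]
      have hc : -(N * (y - δ)) < spinSum σ := by simpa [hA] using hσ
      have : Real.exp (-t * spinSum σ) ≤ Real.exp (-(t - s) * spinSum σ + N * (s * (y - δ))) :=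
        Real.exp_le_exp.2 (by nlinarith)
      linarith [Real.exp_pos (-(t + s) * spinSum σ + -(N * (s * (y + δ))))]
  have hsum := Finset.sum_le_sum fun σ (_ : σ ∈ Finset.univ) => hpt σ
  rw [Finset.sum_add_distrib, Finset.sum_add_distrib, ← Finset.sum_mul, ← Finset.sum_mul,
    sum_exp_mul_spinSum, sum_exp_mul_spinSum, sum_exp_mul_spinSum, Finset.sum_ite_mem,
    Finset.univ_inter, Finset.sum_const, nsmul_eq_mul, Real.cosh_neg, Real.cosh_neg, Real.cosh_neg,
    two_mul_cosh_pow, two_mul_cosh_pow, two_mul_cosh_pow, ← Real.exp_add, ← Real.exp_add] at hsum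
  set E := Real.exp (N * (Real.log 2 + Real.log (Real.cosh t))) with hE
  have e1 : Real.exp (N * (Real.log 2 + Real.log (Real.cosh (t + s))) + -(N * (s * (y + δ)))) =
      E * Real.exp (N * (l (t + s) - l t - s * (y + δ))) := by
    rw [hE, ← Real.exp_add]; congr 1; simp only [hl]; ring
  have e2 : Real.exp (N * (Real.log 2 + Real.log (Real.cosh (t - s))) + N * (s * (y - δ))) =
      E * Real.exp (N * (l (t - s) - l t + s * (y - δ))) := by
    rw [hE, ← Real.exp_add]; congr 1; simp only [hl]; ring
  have e3 : Real.exp (N * (Real.log 2 - rate y - t * δ)) * Real.exp (t * (N * (y + δ))) = E := by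
    rw [hE, ← Real.exp_add, hy, rate_tanh]; congr 1; ring
  have hE0 : 0 < E := Real.exp_pos _
  rw [e1, e2] at hsum
  have hfin : 1 / 2 * E ≤ A.card * Real.exp (t * (N * (y + δ))) := by
    nlinarith [mul_le_mul_of_nonneg_left h1 hE0.le, mul_le_mul_of_nonneg_left h2 hE0.le]
  rw [← e3, ← mul_assoc] at hfin
  exact le_of_mul_le_mul_right hfin (Real.exp_pos _)

/-- Lower bound for the Gaussian tail with variance `1 / N`. -/
lemma le_gaussianReal_Iic {N : ℕ} (hN : 1 ≤ N) {x δ : ℝ} (hx : 0 ≤ x) (hδ : 0 < δ) :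
    δ / √(2 * Real.pi) * Real.exp (-(N * ((x + δ) ^ 2 / 2))) ≤
      (gaussianReal 0 ((N : NNReal)⁻¹)).real (Set.Iic (-x)) := by
  have hN0 : (0 : ℝ) < N := by exact_mod_cast hN
  have hN1 : (1 : ℝ) ≤ N := by exact_mod_cast hN
  have hv : ((N : NNReal)⁻¹) ≠ 0 := by simp; omega
  -- On a window of length `δ` the density is smallest at `-x - δ`; its prefactor `√N` is bounded
  -- below by `1`.
  have hsub : (gaussianReal 0 ((N : NNReal)⁻¹)).real (Set.Icc (-x - δ) (-x)) ≤
      (gaussianReal 0 ((N : NNReal)⁻¹)).real (Set.Iic (-x)) :=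
    measureReal_mono Set.Icc_subset_Iic_self
  refine le_trans ?_ hsub
  rw [measureReal_def, gaussianReal_apply_eq_integral _ hv, ENNReal.toReal_ofReal
    (integral_nonneg fun u => gaussianPDFReal_nonneg _ _ _)]
  have hpdf : ∀ u ∈ Set.Icc (-x - δ) (-x),
      1 / √(2 * Real.pi) * Real.exp (-(N * ((x + δ) ^ 2 / 2))) ≤
        gaussianPDFReal 0 ((N : NNReal)⁻¹) u := by
    intro u hu
    rw [gaussianPDFReal, one_div]
    simp only [NNReal.coe_inv, NNReal.coe_natCast, sub_zero]
    have hu2 : u ^ 2 ≤ (x + δ) ^ 2 := by nlinarith [hu.1, hu.2]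
    refine mul_le_mul ?_ (Real.exp_le_exp.2 ?_) (Real.exp_pos _).le (by positivity)
    · refine inv_anti₀ (by positivity) (Real.sqrt_le_sqrt ?_)
      exact mul_le_of_le_one_right (by positivity) (inv_le_one_of_one_le₀ hN1)
    · have : -u ^ 2 / (2 * (N : ℝ)⁻¹) = -(N * (u ^ 2 / 2)) := by field_simp
      rw [this]
      have := mul_le_mul_of_nonneg_left hu2 hN0.le
      linarith
  have := setIntegral_ge_of_const_le measurableSet_Icc (by simp) hpdf
    (integrable_gaussianPDFReal _ _).integrableOn
  rw [Real.volume_real_Icc_of_le (by linarith), smul_eq_mul] at this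
  refine le_trans (le_of_eq ?_) this
  ring

/-- Borel–Cantelli needs no independence in this direction, which is why the joint law across
different `N` is irrelevant. -/
lemma ae_eventually_notMem_of_exp_bound {Ω : Type*} [MeasurableSpace Ω] {P : Measure Ω}
    {s : ℕ → Set Ω} {C κ : ℝ} (hκ : 0 < κ)
    (h : ∀ᶠ N : ℕ in atTop, P (s N) ≤ ENNReal.ofReal (C * Real.exp (-(N * κ)))) :
    ∀ᵐ ω ∂P, ∀ᶠ N : ℕ in atTop, ω ∉ s N := by
  obtain ⟨M, hM⟩ := eventually_atTop.1 h
  have hsum : Summable fun N : ℕ => C * Real.exp (-(N * κ)) := by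
    have := (Real.summable_exp_nat_mul_iff (a := -κ)).2 (by linarith)
    simpa using this.mul_left C
  have hfin : ∑' N, P (if M ≤ N then s N else ∅) ≠ ⊤ := by
    refine ne_top_of_le_ne_top hsum.tsum_ofReal_ne_top (ENNReal.tsum_le_tsum fun N => ?_)
    split_ifs with hN
    · exact hM N hN
    · simp
  filter_upwards [ae_eventually_notMem hfin] with ω hω
  filter_upwards [hω, eventually_ge_atTop M] with N h1 h2
  rwa [if_pos h2] at h1

lemma partitionFunction_pos (β a h : ℝ) {N : ℕ} (x : Config N → ℝ) :
    0 < partitionFunction β a h x :=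
  Finset.sum_pos (fun _ _ => Real.exp_pos _) Finset.univ_nonempty

/-- Monotonicity of `ℓ^p` norms: `Z (q β) ≤ Z (β) ^ q` for `q ≥ 1`. -/
lemma freeEnergy_mul_le {q β : ℝ} (hq : 1 ≤ q) (a h : ℝ) {N : ℕ} (x : Config N → ℝ) :
    freeEnergy (q * β) a h x ≤ q * freeEnergy β a h x := by
  have hZ := partitionFunction_pos β a h x
  set l := Real.log (partitionFunction β a h x) with hl
  have hle : partitionFunction (q * β) a h x ≤ Real.exp (q * l) := by
    have : ∀ σ : Config N, Real.exp (-(q * β) * hamiltonian a h x σ) ≤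
        Real.exp (-β * hamiltonian a h x σ) * Real.exp ((q - 1) * l) := by
      intro σ
      -- One Boltzmann weight is at most `Z`, so its power `q - 1` is at most `Z ^ (q - 1)`.
      have hσ : -β * hamiltonian a h x σ ≤ l := by
        rw [hl, Real.le_log_iff_exp_le hZ]
        exact Finset.single_le_sum (f := fun σ => Real.exp (-β * hamiltonian a h x σ))
          (fun _ _ => (Real.exp_pos _).le) (Finset.mem_univ σ)
      rw [← Real.exp_add]
      refine Real.exp_le_exp.2 ?_
      nlinarith [mul_le_mul_of_nonneg_left hσ (sub_nonneg.2 hq)]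
    refine (Finset.sum_le_sum fun σ _ => this σ).trans (le_of_eq ?_)
    rw [← Finset.sum_mul]
    change partitionFunction β a h x * _ = _
    rw [← Real.exp_log hZ, ← hl, ← Real.exp_add]; congr 1; ring
  have hlog : Real.log (partitionFunction (q * β) a h x) ≤ q * l := by
    rw [Real.log_le_iff_le_exp (partitionFunction_pos _ _ _ _)]; exact hle
  calc freeEnergy (q * β) a h x ≤ 1 / (N : ℝ) * (q * l) :=
        mul_le_mul_of_nonneg_left hlog (by positivity)
    _ = q * freeEnergy β a h x := by rw [freeEnergy, ← hl]; ring

/-! ### Almost sure bounds by first and second moments. -/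

section Probability

variable {Ω : Type*} [MeasurableSpace Ω] {P : Measure Ω} [IsProbabilityMeasure P]

/-- Chebyshev's inequality for a sum of independent variables with values in `[0, 1]`. -/
lemma measure_sum_le_half_mean {ι : Type*} {A : Finset ι} {X : ι → Ω → ℝ} {p : ℝ}
    (hX : ∀ i, AEMeasurable (X i) P) (h01 : ∀ i ω, X i ω ∈ Set.Icc (0 : ℝ) 1)
    (hind : iIndepFun X P) (hp : ∀ i, ∫ ω, X i ω ∂P = p) (hpos : 0 < A.card * p) :
    P {ω | ∑ i ∈ A, X i ω ≤ A.card * p / 2} ≤ ENNReal.ofReal (4 / (A.card * p)) := by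
  have hL2 : ∀ i, MemLp (X i) 2 P := fun i => MemLp.of_bound (hX i).aestronglyMeasurable 1
    (ae_of_all _ fun ω => by
      rw [Real.norm_eq_abs, abs_of_nonneg (h01 i ω).1]; exact (h01 i ω).2)
  have hp0 : 0 < p := by
    by_contra hneg
    exact absurd hpos (not_lt.2 (mul_nonpos_of_nonneg_of_nonpos (by positivity) (not_lt.1 hneg)))
  have hint : ∫ ω, (∑ i ∈ A, X i) ω ∂P = A.card * p := by
    simp only [Finset.sum_apply]
    rw [integral_finsetSum _ fun i _ => (hL2 i).integrable (by norm_num)]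
    simp [hp]
  -- A variable in `[0, 1]` with mean `p` has variance at most `p (1 - p) ≤ p`.
  have hvar : Var[∑ i ∈ A, X i; P] ≤ A.card * p := by
    rw [IndepFun.variance_sum (fun i _ => hL2 i) fun i _ j _ hij => hind.indepFun hij]
    calc ∑ i ∈ A, Var[X i; P] ≤ ∑ i ∈ A, p := Finset.sum_le_sum fun i _ => by
          have := variance_le_sub_mul_sub (ae_of_all P (h01 i)) (hX i)
          rw [hp] at this
          nlinarith
      _ = A.card * p := by simp
  have hcheb := meas_ge_le_variance_div_sq (memLp_finsetSum' A fun i _ => hL2 i) (half_pos hpos)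
  rw [hint] at hcheb
  refine (measure_mono fun ω hω => ?_).trans (hcheb.trans (ENNReal.ofReal_le_ofReal ?_))
  · simp only [Set.mem_ofPred_eq, Finset.sum_apply] at hω ⊢
    rw [le_abs]; right; linarith
  · rw [div_le_div_iff₀ (by positivity) hpos]
    nlinarith

variable {ξ : (N : ℕ) → Config N → Ω → ℝ}

/-- Annealed upper bound for the free energy. -/
lemma ae_eventually_freeEnergy_le
    (hlaw : ∀ N : ℕ, 1 ≤ N → ∀ σ : Config N, HasLaw (ξ N σ) (gaussianReal 0 ((N : NNReal)⁻¹)) P)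
    (a h β : ℝ) {ε : ℝ} (hε : 0 < ε) :
    ∀ᵐ ω ∂P, ∀ᶠ N : ℕ in atTop, freeEnergy β a h (fun σ => ξ N σ ω) ≤
      Real.log 2 + β ^ 2 * a ^ 2 / 2 + Real.log (Real.cosh (β * h)) + ε := by
  set F := Real.log 2 + β ^ 2 * a ^ 2 / 2 + Real.log (Real.cosh (β * h)) with hF
  have hbd : ∀ᶠ N : ℕ in atTop,
      P {ω | Real.exp (N * (F + ε)) ≤ partitionFunction β a h fun σ => ξ N σ ω} ≤
        ENNReal.ofReal (1 * Real.exp (-(N * ε))) := by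
    filter_upwards [eventually_ge_atTop 1] with N hN
    have hN0 : (0 : ℝ) < N := by exact_mod_cast hN
    have hterm : ∀ (σ : Config N) ω, Real.exp (-β * hamiltonian a h (fun σ => ξ N σ ω) σ) =
        Real.exp ((-(β * a * N)) * ξ N σ ω) * Real.exp (-(β * h) * spinSum σ) := by
      intro σ ω
      rw [← Real.exp_add, hamiltonian]; congr 1; ring
    have hint : ∀ σ : Config N,
        Integrable (fun ω => Real.exp ((-(β * a * N)) * ξ N σ ω)) P := fun σ => by
      have := (hlaw N hN σ).map_eq ▸ integrable_exp_mul_gaussianReal (μ := 0)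
        (v := (N : NNReal)⁻¹) (-(β * a * N))
      exact this.comp_aemeasurable (hlaw N hN σ).aemeasurable
    have hval : ∀ σ : Config N, ∫ ω, Real.exp ((-(β * a * N)) * ξ N σ ω) ∂P =
        Real.exp (N * (β ^ 2 * a ^ 2 / 2)) := fun σ => by
      have := mgf_gaussianReal (hlaw N hN σ).map_eq (-(β * a * N))
      rw [mgf] at this
      rw [this]; congr 1
      simp only [NNReal.coe_inv, NNReal.coe_natCast]
      field_simp; ring
    have hintZ : Integrable (fun ω => partitionFunction β a h fun σ => ξ N σ ω) P := by
      simp only [partitionFunction, hterm]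
      exact integrable_finsetSum _ fun σ _ => (hint σ).mul_const _
    have hEZ : ∫ ω, (partitionFunction β a h fun σ => ξ N σ ω) ∂P = Real.exp (N * F) := by
      simp only [partitionFunction, hterm]
      rw [integral_finsetSum _ fun σ _ => (hint σ).mul_const _]
      simp only [integral_mul_const, hval]
      rw [← Finset.mul_sum, sum_exp_mul_spinSum, Real.cosh_neg, two_mul_cosh_pow, ← Real.exp_add, hF]
      congr 1; ring
    have hmk := mul_meas_ge_le_integral_of_nonneg
      (ae_of_all P fun ω => (partitionFunction_pos β a h fun σ => ξ N σ ω).le) hintZ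
      (Real.exp (N * (F + ε)))
    rw [hEZ] at hmk
    rw [← ofReal_measureReal]
    refine ENNReal.ofReal_le_ofReal ?_
    refine le_of_mul_le_mul_left (hmk.trans (le_of_eq ?_)) (Real.exp_pos (N * (F + ε)))
    rw [one_mul, ← Real.exp_add]; congr 1; ring
  filter_upwards [ae_eventually_notMem_of_exp_bound hε hbd] with ω hω
  filter_upwards [hω, eventually_ge_atTop 1] with N h1 hN
  have hN0 : (0 : ℝ) < N := by exact_mod_cast hN
  simp only [not_le] at h1
  have := (Real.log_lt_iff_lt_exp (partitionFunction_pos _ _ _ _)).2 h1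
  rw [freeEnergy, one_div, inv_mul_le_iff₀ hN0]
  exact this.le

/-- Lower bound for the free energy by the contribution of the configurations with energy density
`x` and magnetization `-tanh t`. -/
lemma ae_eventually_le_freeEnergy
    (hlaw : ∀ N : ℕ, 1 ≤ N → ∀ σ : Config N, HasLaw (ξ N σ) (gaussianReal 0 ((N : NNReal)⁻¹)) P)
    (hindep : ∀ N : ℕ, 1 ≤ N → iIndepFun (ξ N) P)
    {a h β x t ε : ℝ} (ha : 0 < a) (hh : 0 < h) (hβ : 0 < β) (hx : 0 ≤ x) (ht : 0 ≤ t)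
    (hxt : x ^ 2 / 2 + rate (Real.tanh t) < Real.log 2) (hε : 0 < ε) :
    ∀ᵐ ω ∂P, ∀ᶠ N : ℕ in atTop,
      β * (a * x + h * Real.tanh t) + (Real.log 2 - x ^ 2 / 2 - rate (Real.tanh t)) - ε ≤
        freeEnergy β a h (fun σ => ξ N σ ω) := by
  set g := Real.log 2 - x ^ 2 / 2 - rate (Real.tanh t) with hg
  have hg0 : 0 < g := by linarith
  -- The losses are `t δ` in entropy, `x δ + δ²/2` in the Gaussian tail and `β h δ` in energy. The
  -- first condition keeps the expected count growing at rate `κ > 0`; the second fits all losses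
  -- into `ε`.
  obtain ⟨δ, hδ, hδg, hδε⟩ : ∃ δ : ℝ, 0 < δ ∧ t * δ + (x * δ + δ ^ 2 / 2) < g ∧
      t * δ + (x * δ + δ ^ 2 / 2) + β * h * δ < ε := by
    have c1 : Tendsto (fun δ : ℝ => t * δ + (x * δ + δ ^ 2 / 2)) (𝓝[>] 0) (𝓝 0) :=
      (Continuous.tendsto' (by fun_prop) _ _ (by simp)).mono_left nhdsWithin_le_nhds
    have c2 : Tendsto (fun δ : ℝ => t * δ + (x * δ + δ ^ 2 / 2) + β * h * δ) (𝓝[>] 0) (𝓝 0) :=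
      (Continuous.tendsto' (by fun_prop) _ _ (by simp)).mono_left nhdsWithin_le_nhds
    exact ((eventually_mem_nhdsWithin (a := (0 : ℝ)) (s := Set.Ioi 0)).and
      ((c1.eventually_lt_const hg0).and (c2.eventually_lt_const hε))).exists
  set κ := g - (t * δ + (x * δ + δ ^ 2 / 2)) with hκ
  have hκ0 : 0 < κ := by linarith
  set A : (N : ℕ) → Finset (Config N) := fun N =>
    Finset.univ.filter fun σ : Config N => spinSum σ ≤ -(N * (Real.tanh t - δ)) with hA
  set p : ℕ → ℝ := fun N => (gaussianReal 0 ((N : NNReal)⁻¹)).real (Set.Iic (-x)) with hp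
  set X : (N : ℕ) → Config N → Ω → ℝ :=
    fun N σ => (Set.Iic (-x)).indicator (fun _ => (1 : ℝ)) ∘ ξ N σ with hX
  set c := δ / √(2 * Real.pi) / 2 with hc
  have hc0 : 0 < c := by positivity
  have hmean : ∀ᶠ N : ℕ in atTop, c * Real.exp (N * κ) ≤ (A N).card * p N := by
    filter_upwards [eventually_le_card_spinSum_le ht hδ, eventually_ge_atTop 1] with N h1 hN
    have h2 := le_gaussianReal_Iic hN hx hδ
    refine le_trans (le_of_eq ?_) (mul_le_mul h1 h2 (by positivity) (by positivity))
    have : N * κ = N * (Real.log 2 - rate (Real.tanh t) - t * δ) + -(N * ((x + δ) ^ 2 / 2)) := by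
      rw [hκ, hg]; ring
    rw [this, Real.exp_add, hc]; ring
  have hbd : ∀ᶠ N : ℕ in atTop, P {ω | ∑ σ ∈ A N, X N σ ω ≤ (A N).card * p N / 2} ≤
      ENNReal.ofReal (4 / c * Real.exp (-(N * κ))) := by
    filter_upwards [hmean, eventually_ge_atTop 1] with N h1 hN
    have hmeas : Measurable ((Set.Iic (-x)).indicator fun _ => (1 : ℝ)) :=
      measurable_const.indicator measurableSet_Iic
    have hcE : 0 < c * Real.exp (N * κ) := by positivity
    refine (measure_sum_le_half_mean (X := X N) (p := p N)
      (fun σ => hmeas.comp_aemeasurable (hlaw N hN σ).aemeasurable) (fun σ ω => ?_)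
      ((hindep N hN).comp _ fun _ => hmeas) (fun σ => ?_) (hcE.trans_le h1)).trans
      (ENNReal.ofReal_le_ofReal ?_)
    · simp only [hX, Function.comp_apply, Set.indicator_apply]
      split_ifs <;> simp
    · rw [(hlaw N hN σ).integral_comp hmeas.aestronglyMeasurable,
        integral_indicator_const _ measurableSet_Iic]
      simp [hp]
    · refine (div_le_div_of_nonneg_left (by norm_num) hcE h1).trans (le_of_eq ?_)
      rw [Real.exp_neg]; field_simp
  have hlogc : Tendsto (fun N : ℕ => Real.log (c / 2) / (N : ℝ)) atTop (𝓝 0) :=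
    tendsto_const_div_atTop_nhds_zero_nat _
  have hsmall := hlogc.eventually_const_le
    (show t * δ + (x * δ + δ ^ 2 / 2) + β * h * δ - ε < 0 by linarith)
  filter_upwards [ae_eventually_notMem_of_exp_bound hκ0 hbd] with ω hω
  filter_upwards [hω, hmean, hsmall, eventually_ge_atTop 1] with N h1 h2 h3 hN
  have hN0 : (0 : ℝ) < N := by exact_mod_cast hN
  simp only [not_le] at h1
  set e := β * a * x + β * h * (Real.tanh t - δ) with he
  have hpt : ∀ σ ∈ A N, X N σ ω * Real.exp (N * e) ≤
      Real.exp (-β * hamiltonian a h (fun σ => ξ N σ ω) σ) := by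
    intro σ hσ
    simp only [hX, Function.comp_apply, Set.indicator_apply, Set.mem_Iic]
    split_ifs with hξ
    · rw [one_mul, hamiltonian]
      refine Real.exp_le_exp.2 ?_
      have hS : spinSum σ ≤ -(N * (Real.tanh t - δ)) := by simpa [hA] using hσ
      have b1 := mul_le_mul_of_nonneg_left hξ (by positivity : 0 ≤ β * a * N)
      have b2 := mul_le_mul_of_nonneg_left hS (by positivity : 0 ≤ β * h)
      rw [he]
      linarith
    · rw [zero_mul]; exact (Real.exp_pos _).le
  have hZ : c / 2 * Real.exp (N * κ) * Real.exp (N * e) ≤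
      partitionFunction β a h fun σ => ξ N σ ω := by
    calc c / 2 * Real.exp (N * κ) * Real.exp (N * e)
        ≤ (∑ σ ∈ A N, X N σ ω) * Real.exp (N * e) :=
          mul_le_mul_of_nonneg_right (by linarith) (Real.exp_pos _).le
      _ = ∑ σ ∈ A N, X N σ ω * Real.exp (N * e) := Finset.sum_mul ..
      _ ≤ ∑ σ ∈ A N, Real.exp (-β * hamiltonian a h (fun σ => ξ N σ ω) σ) := Finset.sum_le_sum hpt
      _ ≤ _ := Finset.sum_le_sum_of_subset_of_nonneg (Finset.subset_univ _)
          fun _ _ _ => (Real.exp_pos _).le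
  have hlog := Real.log_le_log (by positivity) hZ
  rw [Real.log_mul (by positivity) (by positivity), Real.log_mul (by positivity) (by positivity),
    Real.log_exp, Real.log_exp] at hlog
  rw [freeEnergy, one_div, le_inv_mul_iff₀ hN0]
  rw [le_div_iff₀ hN0] at h3
  refine le_trans ?_ hlog
  rw [hκ, he]
  nlinarith

end Probability

/-! ### Matching the bounds in the two phases. -/

section Limit

variable {Ω : Type*} [MeasurableSpace Ω] {P : Measure Ω} [IsProbabilityMeasure P]
  {ξ : (N : ℕ) → Config N → Ω → ℝ}

lemma ae_tendsto_of_forall_pos {Ω : Type*} [MeasurableSpace Ω] {P : Measure Ω}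
    {f : ℕ → Ω → ℝ} {L : ℝ}
    (hlow : ∀ ε > 0, ∀ᵐ ω ∂P, ∀ᶠ N : ℕ in atTop, L - ε ≤ f N ω)
    (hup : ∀ ε > 0, ∀ᵐ ω ∂P, ∀ᶠ N : ℕ in atTop, f N ω ≤ L + ε) :
    ∀ᵐ ω ∂P, Tendsto (fun N => f N ω) atTop (𝓝 L) := by
  have h1 := ae_all_iff.2 fun n : ℕ => hlow (1 / ((n : ℝ) + 1)) (by positivity)
  have h2 := ae_all_iff.2 fun n : ℕ => hup (1 / ((n : ℝ) + 1)) (by positivity)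
  filter_upwards [h1, h2] with ω l u
  refine tendsto_order.2 ⟨fun b hb => ?_, fun b hb => ?_⟩
  · obtain ⟨n, hn⟩ := exists_nat_one_div_lt (sub_pos.2 hb)
    filter_upwards [l n] with N hN
    linarith
  · obtain ⟨n, hn⟩ := exists_nat_one_div_lt (sub_pos.2 hb)
    filter_upwards [u n] with N hN
    linarith

/-- The lower bound `ae_eventually_le_freeEnergy` on the boundary of the admissible region. -/
lemma ae_eventually_le_freeEnergy_of_le
    (hlaw : ∀ N : ℕ, 1 ≤ N → ∀ σ : Config N, HasLaw (ξ N σ) (gaussianReal 0 ((N : NNReal)⁻¹)) P)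
    (hindep : ∀ N : ℕ, 1 ≤ N → iIndepFun (ξ N) P)
    {a h β x t ε : ℝ} (ha : 0 < a) (hh : 0 < h) (hβ : 0 < β) (hx : 0 < x) (ht : 0 ≤ t)
    (hxt : x ^ 2 / 2 + rate (Real.tanh t) ≤ Real.log 2) (hε : 0 < ε) :
    ∀ᵐ ω ∂P, ∀ᶠ N : ℕ in atTop,
      β * (a * x + h * Real.tanh t) + (Real.log 2 - x ^ 2 / 2 - rate (Real.tanh t)) - ε ≤
        freeEnergy β a h (fun σ => ξ N σ ω) := by
  -- Lowering `x` by `η` makes the constraint strict and only raises the entropy, at an energy cost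
  -- `β a η ≤ ε / 2`.
  set η := min (x / 2) (ε / (2 * (β * a))) with hη
  have hη0 : 0 < η := by positivity
  have hηx : η ≤ x / 2 := min_le_left _ _
  have hηε : β * a * η ≤ ε / 2 := by
    have := min_le_right (x / 2) (ε / (2 * (β * a)))
    rw [le_div_iff₀ (by positivity)] at this
    rw [hη]; linarith
  filter_upwards [ae_eventually_le_freeEnergy hlaw hindep (x := x - η) (ε := ε / 2) ha hh hβ
    (by linarith) ht (by nlinarith) (half_pos hε)] with ω hω
  filter_upwards [hω] with N hN
  nlinarith

variable {a h β t x : ℝ}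

/-- At the unconstrained maximizer `x = β a`, `t = β h` the lower bound equals the annealed one. -/
lemma ae_tendsto_freeEnergy_high_temp
    (hlaw : ∀ N : ℕ, 1 ≤ N → ∀ σ : Config N, HasLaw (ξ N σ) (gaussianReal 0 ((N : NNReal)⁻¹)) P)
    (hindep : ∀ N : ℕ, 1 ≤ N → iIndepFun (ξ N) P)
    (ha : 0 < a) (hh : 0 < h) (hβ : 0 < β)
    (hle : β ^ 2 * a ^ 2 / 2 + rate (Real.tanh (β * h)) ≤ Real.log 2) :
    ∀ᵐ ω ∂P, Tendsto (fun N : ℕ => freeEnergy β a h (fun σ => ξ N σ ω)) atTop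
      (𝓝 (Real.log 2 + β ^ 2 * a ^ 2 / 2 + Real.log (Real.cosh (β * h)))) := by
  refine ae_tendsto_of_forall_pos (fun ε hε => ?_) fun ε hε =>
    ae_eventually_freeEnergy_le hlaw a h β hε
  filter_upwards [ae_eventually_le_freeEnergy_of_le hlaw hindep (x := β * a) (t := β * h) ha hh hβ
    (by positivity) (by positivity) (by rwa [mul_pow]) hε] with ω hω
  filter_upwards [hω] with N hN
  refine le_trans (le_of_eq ?_) hN
  rw [rate_tanh]; ring

lemma ae_tendsto_freeEnergy_low_temp
    (hlaw : ∀ N : ℕ, 1 ≤ N → ∀ σ : Config N, HasLaw (ξ N σ) (gaussianReal 0 ((N : NNReal)⁻¹)) P)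
    (hindep : ∀ N : ℕ, 1 ≤ N → iIndepFun (ξ N) P)
    (ha : 0 < a) (hh : 0 < h) (hβ : 0 < β) (ht : 0 < t) (hx : x = a * t / h)
    (hxt : x ^ 2 / 2 + rate (Real.tanh t) = Real.log 2) (hle : t ≤ β * h) :
    ∀ᵐ ω ∂P, Tendsto (fun N : ℕ => freeEnergy β a h (fun σ => ξ N σ ω)) atTop
      (𝓝 (β * (a * x + h * Real.tanh t))) := by
  have hx0 : 0 < x := by rw [hx]; positivity
  refine ae_tendsto_of_forall_pos (fun ε hε => ?_) fun ε hε => ?_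
  · filter_upwards [ae_eventually_le_freeEnergy_of_le hlaw hindep (x := x) (t := t) ha hh hβ
      hx0 ht.le hxt.le hε] with ω hω
    filter_upwards [hω] with N hN
    linarith
  -- The critical inverse temperature: `b h = t` and `b a = x`, so by `hxt` the annealed value at
  -- `b` is `b (a x + h tanh t)`. Scaling by `β / b ≥ 1` gives the upper bound.
  · set b := t / h with hb
    have hb0 : 0 < b := by positivity
    have hq : 1 ≤ β / b := by
      rw [one_le_div hb0, hb, div_le_iff₀ hh]; exact hle
    filter_upwards [ae_eventually_freeEnergy_le hlaw a h b (ε := ε / (β / b)) (by positivity)]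
      with ω hω
    filter_upwards [hω] with N hN
    have hmono := freeEnergy_mul_le hq a h (β := b) fun σ => ξ N σ ω
    rw [div_mul_cancel₀ _ hb0.ne'] at hmono
    refine hmono.trans ((mul_le_mul_of_nonneg_left hN (by positivity)).trans (le_of_eq ?_))
    have hbh : b * h = t := by rw [hb]; field_simp
    have hxb : x = b * a := by rw [hx, hb]; ring
    have hF : Real.log 2 + b ^ 2 * a ^ 2 / 2 + Real.log (Real.cosh (b * h)) =
        b * (a * x + h * Real.tanh t) := by
      rw [rate_tanh] at hxt
      rw [hbh, ← hxt, hxb, ← hbh]; ring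
    rw [mul_add, mul_div_cancel₀ _ (by positivity), hF, ← mul_assoc, div_mul_cancel₀ _ hb0.ne']

end Limit

end GaussianREM

/-! ### Locating the phase boundary. -/

theorem theorem4p4p1
    {Ω : Type*} [MeasurableSpace Ω] (P : Measure Ω) [IsProbabilityMeasure P]
    (a h β : ℝ) (ha : 0 < a) (hh : 0 < h) (hβ : 0 < β)
    (ξ : (N : ℕ) → GaussianREM.Config N → Ω → ℝ)
    (hlaw : ∀ N : ℕ, 1 ≤ N → ∀ σ : GaussianREM.Config N,
      HasLaw (ξ N σ) (gaussianReal 0 ((N : NNReal)⁻¹)) P)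
    (hindep : ∀ N : ℕ, 1 ≤ N → iIndepFun (ξ N) P) :
    (∃! y₀ : ℝ, GaussianREM.IsYZero a h y₀) ∧
    (β ≤ (1 / a) * √(2 * Real.log 2) → ∃! c : ℝ, GaussianREM.IsCBeta β a c) ∧
    ∀ y₀ x₀ : ℝ, GaussianREM.IsYZero a h y₀ → x₀ = a * Real.artanh y₀ / h →
      (∀ c : ℝ, β ≤ (1 / a) * √(2 * Real.log 2) → GaussianREM.IsCBeta β a c → y₀ ≤ c →
        ∀ᵐ ω ∂P, Tendsto (fun N : ℕ => GaussianREM.freeEnergy β a h (fun σ => ξ N σ ω)) atTop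
          (𝓝 (Real.log 2 + β ^ 2 * a ^ 2 / 2 + Real.log (Real.cosh (β * h))))) ∧
      (∀ c : ℝ, β ≤ (1 / a) * √(2 * Real.log 2) → GaussianREM.IsCBeta β a c → c < y₀ →
        ∀ᵐ ω ∂P, Tendsto (fun N : ℕ => GaussianREM.freeEnergy β a h (fun σ => ξ N σ ω)) atTop
          (𝓝 (β * (a * x₀ + h * y₀)))) ∧
      ((1 / a) * √(2 * Real.log 2) < β →
        ∀ᵐ ω ∂P, Tendsto (fun N : ℕ => GaussianREM.freeEnergy β a h (fun σ => ξ N σ ω)) atTop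
          (𝓝 (β * (a * x₀ + h * y₀)))) := by
  refine ⟨GaussianREM.existsUnique_isYZero ha hh, GaussianREM.existsUnique_isCBeta ha hβ, ?_⟩
  rintro y₀ x₀ ⟨hy0, hy1, hy⟩ hx
  obtain ⟨t, ht0, rfl⟩ := GaussianREM.exists_eq_tanh hy0 hy1
  rw [Real.artanh_tanh] at hy hx
  have ht : 0 < t := ht0.lt_of_ne fun e => hh.ne (by rw [← hy, ← e]; simp)
  have hgap := GaussianREM.rate_tanh_lt ht0
  have hx0 : 0 < x₀ := by rw [hx]; positivity
  have hxs : x₀ = √(2 * (Real.log 2 - GaussianREM.rate (Real.tanh t))) := by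
    rw [div_eq_iff (Real.sqrt_pos.2 (by linarith)).ne'] at hy
    rw [hx, hy, mul_div_cancel_left₀ _ hh.ne']
  have hxt : x₀ ^ 2 / 2 + GaussianREM.rate (Real.tanh t) = Real.log 2 := by
    rw [hxs, Real.sq_sqrt (by linarith)]; ring
  have hth : t = x₀ * h / a := by rw [hx]; field_simp
  have low (hlt : x₀ ≤ β * a) : t ≤ β * h := by
    rw [hth, div_le_iff₀ ha]; nlinarith
  refine ⟨?_, ?_, fun hlt => ?_⟩
  · rintro c - ⟨hc0, hc1, hc⟩ hle
    obtain ⟨s, hs, rfl⟩ := GaussianREM.exists_eq_tanh hc0 hc1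
    have hts : t ≤ s := by
      by_contra hlt
      refine hle.not_gt ?_
      have := (Real.artanh_lt_artanh_iff (x := Real.tanh s) (y := Real.tanh t)
        ⟨Real.neg_one_lt_tanh _, Real.tanh_lt_one _⟩
        ⟨Real.neg_one_lt_tanh _, Real.tanh_lt_one _⟩).1
      rw [Real.artanh_tanh, Real.artanh_tanh] at this
      exact this (not_le.1 hlt)
    have hr := GaussianREM.strictMonoOn_rate_tanh.monotoneOn ht0 hs hts
    -- Both rates are `log 2` minus a half square, of `x₀` at `t` and of `β a` at `s`, so `t ≤ s`
    -- reverses to `β a ≤ x₀`.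
    have hβx : β * a ≤ x₀ := by
      refine (pow_le_pow_iff_left₀ (by positivity) (by positivity) two_ne_zero).1 ?_
      rw [mul_pow]; linarith
    have hβt : β * h ≤ t := by
      rw [hth, le_div_iff₀ ha]; nlinarith
    have hr' := GaussianREM.strictMonoOn_rate_tanh.monotoneOn
      (show 0 ≤ β * h by positivity) hs (hβt.trans hts)
    exact GaussianREM.ae_tendsto_freeEnergy_high_temp hlaw hindep ha hh hβ (by linarith)
  · rintro c - ⟨hc0, hc1, hc⟩ hlt
    obtain ⟨s, hs, rfl⟩ := GaussianREM.exists_eq_tanh hc0 hc1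
    have hst : s ≤ t := by
      have := Real.artanh_le_artanh (Real.neg_one_lt_tanh s) (Real.tanh_lt_one t) hlt.le
      rwa [Real.artanh_tanh, Real.artanh_tanh] at this
    have hr := GaussianREM.strictMonoOn_rate_tanh.monotoneOn hs ht0 hst
    refine GaussianREM.ae_tendsto_freeEnergy_low_temp hlaw hindep ha hh hβ ht hx hxt (low ?_)
    refine (pow_le_pow_iff_left₀ (by positivity) (by positivity) two_ne_zero).1 ?_
    rw [mul_pow]; linarith
  · refine GaussianREM.ae_tendsto_freeEnergy_low_temp hlaw hindep ha hh hβ ht hx hxt (low ?_)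
    rw [one_div, inv_mul_eq_div, div_lt_iff₀ ha] at hlt
    refine le_trans ?_ hlt.le
    rw [hxs]
    -- Nonnegativity of the rate gives `x₀ ≤ √(2 log 2)`, so `x₀ < β a` in this range of `β`.
    refine Real.sqrt_le_sqrt ?_
    have := GaussianREM.strictMonoOn_rate_tanh.monotoneOn Set.self_mem_Ici ht0 ht0
    simp only [GaussianREM.rate_tanh_zero] at this
    linarith
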